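/- Let $\xi(t)=\sum_{k\le\nu(t)}\xi_k$, $t\ge 0$, be a compound Poisson process, where $\nu$ is a Poisson process of rate $\lambda>0$ and the jumps $\xi_k$ are i.i.d., independent of $\nu$, with $$P\{\xi_k<x\}=q e^{bx}\ (x\le 0),\qquad P\{\xi_k<x\}=1-pe^{-cx}\ (x>0),$$ where $b,c>0$, $p,q>0$, $p+q=1$. Equivalently, $E e^{i\alpha\xi(t)}=e^{t\psi(\alpha)}$ with $\psi(\alpha)=\lambda p\left(\frac{c}{c-i\alpha}-1\right)+\lambda q\left(\frac{b}{b+i\alpha}-1\right)$. Put $m=E\,\xi(1)=\lambda\left(\frac pc-\frac qb\right)$. For $0<x<T$ let $\tau=\inf\{t>0:\xi(t)\notin(x-T,x)\}$, $A_+=\{\tau<\infty,\ \xi(\tau)\ge x\}$, $A_-=\{\tau<\infty,\ \xi(\tau)\le x-T\}$, and let $$Q^T(x)=\lim_{s\downarrow 0}E[e^{-s\tau};A_+]=P(A_+),\qquad Q_T(x)=\lim_{s\downarrow 0}E[e^{-s\tau};A_-]=P(A_-).$$ For $s>0$ let $\theta_s$ be an exponential random variable of rate $s$ independent of $\xi$,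 and let $p_+(s)=P\{\sup_{0\le u\le\theta_s}\xi(u)=0\}$, $p_-(s)=P\{\inf_{0\le u\le\theta_s}\xi(u)=0\}$. If $m>0$, the limit $p_-=\lim_{s\downarrow0}p_-(s)$ exists and is positive; put $q_-=1-p_-$ and $\rho_-=bp_->0$; then $-\rho_-$ is a root of $\psi(-ir)=0$. If $m<0$, the limit $p_+=\lim_{s\downarrow0}p_+(s)$ exists and is positive; put $q_+=1-p_+$ and $\rho_+=cp_+>0$; then $\rho_+$ is a root of $\psi(-ir)=0$. For all $0<x<T$, $$Q^T(x)=\begin{cases} \dfrac{1-q_-e^{\rho_-(x-T)}}{1-q_-\frac{c}{c+\rho_-}e^{-\rho_-T}}, & m>0,\\[3mm] \dfrac{q_+e^{-\rho_+x}\left(1-\frac{b}{\rho_++b}e^{\rho_+(x-T)}\right)}{1-\frac{b}{\rho_++b}\,q_+e^{-\rho_+T}}, & m<0,\\[3mm] \dfrac{c(1+b(T-x))}{b+c+bcT}, & m=0. \end{cases}$$ In the symmetric case $p=q=\frac12$, $b=c$, for all $0<x<T$, $$Q^T(x)=\frac{1+c(T-x)}{2+cT},\qquad Q_T(x)=\frac{1+cx}{2+cT}.$$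 -/

import Mathlib

open MeasureTheory ProbabilityTheory Filter Topology
open scoped ENNReal

noncomputable section

namespace CompoundPoisson

/-- Law of a jump: positive exponential of rate `c` with probability `p`, negative exponential of
rate `b` with probability `q`; that is `P(X < x) = q e^{bx}` for `x ≤ 0` and
`P(X < x) = 1 - p e^{-cx}` for `x > 0` (when `p + q = 1`). -/
def jumpLaw (p q b c : ℝ) : Measure ℝ :=
  ENNReal.ofReal p • expMeasure c + ENNReal.ofReal q • (expMeasure b).map (fun y => -y)

/-- The random input of the compound Poisson process: waiting times `ζ k` between jumps, i.i.d.
exponential of rate `lam`, and jump sizes `X k`, i.i.d. with law `jumpLaw p q b c`, the two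
sequences being independent of each other. -/
structure IsInput {Ω : Type*} [MeasurableSpace Ω] (μ : Measure Ω) (lam p q b c : ℝ)
    (ζ X : ℕ → Ω → ℝ) : Prop where
  measurable_wait : ∀ k, Measurable (ζ k)
  measurable_jump : ∀ k, Measurable (X k)
  law_wait : ∀ k, μ.map (ζ k) = expMeasure lam
  law_jump : ∀ k, μ.map (X k) = jumpLaw p q b c
  indep_wait : iIndepFun ζ μ
  indep_jump : iIndepFun X μ
  indep_wait_jump : IndepFun (fun ω k => ζ k ω) (fun ω k => X k ω) μ

variable {Ω : Type*}

/-- Time of the jump number `k` (counted from `0`). -/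
def arrival (ζ : ℕ → Ω → ℝ) (k : ℕ) (ω : Ω) : ℝ := ∑ i ∈ Finset.range (k + 1), ζ i ω

/-- The Poisson process `ν(t)`: the number of jumps up to and including time `t`. -/
def count (ζ : ℕ → Ω → ℝ) (t : ℝ) (ω : Ω) : ℕ := {k : ℕ | arrival ζ k ω ≤ t}.ncard

/-- The compound Poisson process `ξ(t)`, the sum of the first `ν(t)` jumps. -/
def path (ζ X : ℕ → Ω → ℝ) (t : ℝ) (ω : Ω) : ℝ := ∑ k ∈ Finset.range (count ζ t ω), X k ω

/-- The first exit time `τ(x,T) = inf {t > 0 : ξ(t) ∉ (x - T, x)}`, equal to `∞` if there is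
no exit. -/
def exitTime (ζ X : ℕ → Ω → ℝ) (x T : ℝ) (ω : Ω) : ℝ≥0∞ :=
  sInf (ENNReal.ofReal '' {t : ℝ | 0 < t ∧ path ζ X t ω ∉ Set.Ioo (x - T) x})

/-- The event `A₊(x)`: exit through the upper boundary. -/
def exitUp (ζ X : ℕ → Ω → ℝ) (x T : ℝ) : Set Ω :=
  {ω | exitTime ζ X x T ω < ∞ ∧ x ≤ path ζ X (exitTime ζ X x T ω).toReal ω}

/-- The event `A₋(x)`: exit through the lower boundary. -/
def exitDown (ζ X : ℕ → Ω → ℝ) (x T : ℝ) : Set Ω :=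
  {ω | exitTime ζ X x T ω < ∞ ∧ path ζ X (exitTime ζ X x T ω).toReal ω ≤ x - T}

/-- The running supremum `ξ⁺(t)` of the process over `[0, t]`. -/
def runSup (ζ X : ℕ → Ω → ℝ) (t : ℝ) (ω : Ω) : ℝ :=
  sSup ((fun u => path ζ X u ω) '' Set.Icc 0 t)

/-- The running infimum `ξ⁻(t)` of the process over `[0, t]`. -/
def runInf (ζ X : ℕ → Ω → ℝ) (t : ℝ) (ω : Ω) : ℝ :=
  sInf ((fun u => path ζ X u ω) '' Set.Icc 0 t)

variable [MeasurableSpace Ω]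

/-- `Q^T(s,x) = E[exp(-s τ(x,T)), A₊(x)]`. -/
def upTransform (μ : Measure Ω) (ζ X : ℕ → Ω → ℝ) (T s x : ℝ) : ℝ :=
  ∫ ω in exitUp ζ X x T, Real.exp (-s * (exitTime ζ X x T ω).toReal) ∂μ

/-- `Q_T(s,x) = E[exp(-s τ(x,T)), A₋(x)]`. -/
def downTransform (μ : Measure Ω) (ζ X : ℕ → Ω → ℝ) (T s x : ℝ) : ℝ :=
  ∫ ω in exitDown ζ X x T, Real.exp (-s * (exitTime ζ X x T ω).toReal) ∂μ

/-- `Q^T(x) = v`: the number `v` is the limit of `Q^T(s,x)` as `s ↓ 0`, and it is the probability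
of exit through the upper boundary. -/
def UpProbEq (μ : Measure Ω) (ζ X : ℕ → Ω → ℝ) (T x v : ℝ) : Prop :=
  Tendsto (fun s => upTransform μ ζ X T s x) (𝓝[>] 0) (𝓝 v) ∧ μ.real (exitUp ζ X x T) = v

/-- `Q_T(x) = v`: the number `v` is the limit of `Q_T(s,x)` as `s ↓ 0`, and it is the probability
of exit through the lower boundary. -/
def DownProbEq (μ : Measure Ω) (ζ X : ℕ → Ω → ℝ) (T x v : ℝ) : Prop :=
  Tendsto (fun s => downTransform μ ζ X T s x) (𝓝[>] 0) (𝓝 v) ∧ μ.real (exitDown ζ X x T) = v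

/-- `p₊(s) = P(ξ⁺(θ_s) = 0)`, where `θ_s` is exponential of rate `s` and independent of `ξ`. -/
def pPlus (μ : Measure Ω) (ζ X : ℕ → Ω → ℝ) (s : ℝ) : ℝ :=
  (μ.prod (expMeasure s)).real {z | runSup ζ X z.2 z.1 = 0}

/-- `p₋(s) = P(ξ⁻(θ_s) = 0)`, where `θ_s` is exponential of rate `s` and independent of `ξ`. -/
def pMinus (μ : Measure Ω) (ζ X : ℕ → Ω → ℝ) (s : ℝ) : ℝ :=
  (μ.prod (expMeasure s)).real {z | runInf ζ X z.2 z.1 = 0}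

/-- The cumulant `ψ(α) = λp(c(c - iα)⁻¹ - 1) + λq(b(b + iα)⁻¹ - 1)`. -/
def cumulant (lam p q b c : ℝ) (α : ℂ) : ℂ :=
  lam * p * (c * (c - Complex.I * α)⁻¹ - 1) + lam * q * (b * (b + Complex.I * α)⁻¹ - 1)

/-- The mean drift `m = E ξ(1) = λ(p/c - q/b)`. -/
def drift (lam p q b c : ℝ) : ℝ := lam * (p / c - q / b)

end CompoundPoisson

end

open CompoundPoisson

namespace CompoundPoisson

/-! Between jumps the process is constant, so the side of exit from `(x - T, x)` is decided by the
embedded random walk of the jumps alone; the waiting times matter only for `τ`. Hence `Q^T(x)` is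
the value at `0` of a bounded function that is harmonic for the walk inside the interval, equal to
`1` above it and to `0` below it (`measureReal_passage_eq`).

The harmonic function is explicit because an exponential jump has no memory. If `F` is the function
inside `(l, u)`, its averages `U` and `D` over upward and downward jumps satisfy `U' = c (U - F)`
and `D' = b (F - D)`, with `U u = 1` and `D l = 0`, and harmonicity reads `p U + q D = F`. The
solutions are `A + B e^{rs}` with `r = q c - p b`, the nonzero root of `E e^{rX} = 1`; they become
`A + B s` when `r = 0`, that is, when `m = 0`. The two boundary values fix `A` and `B`
(`measureReal_passage_exp`, `measureReal_passage_linear`).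

For the constants of the formula, `p_-(s)` tends to the probability that the walk is never negative
(`tendsto_pMinus`). For `m > 0` this is the limit, as `n → ∞`, of the probabilities of leaving `[0,
n + 1)` upwards, which the same formula gives: `p_- = (p b - q c) / b`, so that `ρ_- = -r`
(`measureReal_forall_nonneg`). The case `m < 0` follows by reflection. What remains is algebra. The
limits as `s ↓ 0` of the transforms are dominated convergence. -/

/-! ### Exponential laws. -/

lemma expMeasure_eq_withDensity (c : ℝ) :
    expMeasure c = volume.withDensity (exponentialPDF c) := rfl

lemma integral_expMeasure (c : ℝ) (hc : 0 < c) (g : ℝ → ℝ) :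
    ∫ y, g y ∂(expMeasure c) = ∫ y in Set.Ioi 0, c * Real.exp (-(c * y)) * g y := by
  rw [expMeasure_eq_withDensity, integral_withDensity_eq_integral_toReal_smul
    (by unfold exponentialPDF; fun_prop) (by simp [exponentialPDF]), ← integral_Ici_eq_integral_Ioi,
    ← integral_indicator measurableSet_Ici]
  refine integral_congr_ae (Eventually.of_forall fun y => ?_)
  by_cases hy : 0 ≤ y
  · simp only [exponentialPDF_of_nonneg hy, Set.indicator, Set.mem_Ici, hy, if_true, smul_eq_mul]
    rw [ENNReal.toReal_ofReal (by positivity)]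
  · simp [exponentialPDF_of_neg (not_le.1 hy), Set.indicator, hy]

/-- The average of `g` under an exponential law of rate `c`, when `g` is `f` before `a` and constant
after `a`, is read off from the solution of the linear equation `G' = c (G - f)`. -/
lemma integral_expMeasure_eq_of_hasDerivAt {c a K : ℝ} (hc : 0 < c) (ha : 0 ≤ a) {g f G : ℝ → ℝ}
    (hg : Integrable g (expMeasure c)) (hf : Continuous f)
    (hgf : ∀ y, 0 < y → y < a → g y = f y) (hgK : ∀ y, a < y → g y = K)
    (hG : ∀ y, HasDerivAt G (c * (G y - f y)) y) (hGa : G a = K) :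
    ∫ y, g y ∂(expMeasure c) = G 0 := by
  have := isProbabilityMeasure_expMeasure hc
  have h1 : ∫ y, (g y - K) ∂(expMeasure c) = G 0 - K := by
    rw [integral_expMeasure c hc]
    have h2 : ∫ y in Set.Ioi 0, c * Real.exp (-(c * y)) * (g y - K)
        = ∫ y in Set.Ioc 0 a, c * Real.exp (-(c * y)) * (f y - K) := by
      rw [← integral_indicator measurableSet_Ioi, ← integral_indicator measurableSet_Ioc]
      refine integral_congr_ae ?_
      -- Nothing is known of `g a`, but a single point is null. This is why the endpoints of the
      -- interval may later belong to it or not.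
      have hne : ∀ᵐ y : ℝ, y ≠ a := by simp [ae_iff]
      filter_upwards [hne] with y hy
      simp only [Set.indicator, Set.mem_Ioi, Set.mem_Ioc]
      by_cases h0 : 0 < y
      · rcases lt_or_gt_of_ne hy with h | h
        · simp [h0, h.le, hgf y h0 h]
        · simp [h0, not_le.2 h, hgK y h]
      · simp [h0]
    -- By the equation for `G`, the function `-e^{-cy} (G y - K)` is a primitive of the integrand;
    -- it vanishes at `a` because `G a = K`.
    rw [h2, ← intervalIntegral.integral_of_le ha,
      intervalIntegral.integral_eq_sub_of_hasDerivAt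
        (f := fun y => -Real.exp (-(c * y)) * (G y - K))]
    · simp [hGa]
    · intro y _
      have he : HasDerivAt (fun y => -Real.exp (-(c * y))) (c * Real.exp (-(c * y))) y :=
        hasDerivAt_neg_exp_mul_exp
      exact (he.fun_mul ((hG y).sub_const K)).congr_deriv (by ring)
    · exact Continuous.intervalIntegrable (by fun_prop) _ _
  rw [integral_sub hg (integrable_const K)] at h1
  simp at h1
  linarith

lemma expMeasure_real_Iic {c : ℝ} (hc : 0 < c) {a : ℝ} (ha : 0 ≤ a) :
    (expMeasure c).real (Set.Iic a) = 1 - Real.exp (-(c * a)) := by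
  have := isProbabilityMeasure_expMeasure hc
  rw [← cdf_eq_real, cdf_expMeasure_eq hc, if_pos ha]

lemma expMeasure_Ioi_pos {c : ℝ} (hc : 0 < c) (a : ℝ) : 0 < expMeasure c (Set.Ioi a) := by
  have := isProbabilityMeasure_expMeasure hc
  have h : 0 < expMeasure c (Set.Ioi (max a 0)) := by
    rw [← Set.compl_Iic, prob_compl_eq_one_sub measurableSet_Iic, tsub_pos_iff_lt,
      ← ENNReal.toReal_lt_toReal (measure_ne_top _ _) (by simp)]
    have := expMeasure_real_Iic hc (le_max_right a 0)
    rw [Measure.real] at this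
    rw [this]
    simp [Real.exp_pos]
  exact h.trans_le (measure_mono (Set.Ioi_subset_Ioi (le_max_left _ _)))

lemma ae_expMeasure_pos {c : ℝ} (hc : 0 < c) : ∀ᵐ y ∂(expMeasure c), 0 < y := by
  have := isProbabilityMeasure_expMeasure hc
  have h := expMeasure_real_Iic hc le_rfl
  rw [ae_iff]
  simp only [mul_zero, neg_zero, Real.exp_zero, sub_self] at h
  rw [measureReal_eq_zero_iff] at h
  simpa [Set.Iic] using h

/-! ### The jump law and its harmonic functions. -/

section JumpLaw

variable {p q b c : ℝ}

lemma integral_jumpLaw (hp : 0 < p) (hq : 0 < q) (hb : 0 < b) (hc : 0 < c) {g : ℝ → ℝ}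
    (hg : Measurable g) {C : ℝ} (hC : ∀ y, |g y| ≤ C) :
    ∫ y, g y ∂(jumpLaw p q b c)
      = p * ∫ y, g y ∂(expMeasure c) + q * ∫ y, g (-y) ∂(expMeasure b) := by
  have := isProbabilityMeasure_expMeasure hc
  have := isProbabilityMeasure_expMeasure hb
  have hgb : ∀ (ν : Measure ℝ) [IsFiniteMeasure ν], Integrable g ν := fun ν _ =>
    Integrable.of_bound hg.aestronglyMeasurable C (Eventually.of_forall hC)
  have := Measure.isProbabilityMeasure_map (μ := expMeasure b) (f := fun y : ℝ => -y)
    (by fun_prop)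
  rw [jumpLaw, integral_add_measure ((hgb _).smul_measure (by simp))
    ((hgb _).smul_measure (by simp)), integral_smul_measure, integral_smul_measure,
    integral_map (by fun_prop) hg.aestronglyMeasurable]
  simp [ENNReal.toReal_ofReal, hp.le, hq.le]

lemma jumpLaw_Ioi_pos (hp : 0 < p) (hc : 0 < c) (a : ℝ) : 0 < jumpLaw p q b c (Set.Ioi a) := by
  rw [jumpLaw]
  simp only [Measure.add_apply, Measure.smul_apply, smul_eq_mul]
  exact (ENNReal.mul_pos (by simpa using hp) (expMeasure_Ioi_pos hc a).ne').trans_le le_self_add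

lemma jumpLaw_map_neg : (jumpLaw p q b c).map (fun y => -y) = jumpLaw q p c b := by
  rw [jumpLaw, jumpLaw, Measure.map_add _ _ (by fun_prop), Measure.map_smul, Measure.map_smul,
    Measure.map_map (by fun_prop) (by fun_prop), add_comm]
  congr 2
  have : ((fun y : ℝ => -y) ∘ fun y => -y) = id := by ext; simp
  rw [this, Measure.map_id]

/-- The function equal to `F` on `I`, to `1` above `I` and to `0` below `I` (for `0 ∈ I`). -/
noncomputable def boundaryExtend (I : Set ℝ) (F : ℝ → ℝ) (s : ℝ) : ℝ :=
  open Classical in if s ∈ I then F s else if 0 < s then 1 else 0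

lemma measurable_boundaryExtend {I : Set ℝ} (hI : MeasurableSet I) {F : ℝ → ℝ} (hF : Continuous F) :
    Measurable (boundaryExtend I F) := by
  classical
  unfold boundaryExtend
  refine Measurable.ite (by simpa using hI) hF.measurable ?_
  exact Measurable.ite measurableSet_Ioi measurable_const measurable_const

lemma exists_bound_boundaryExtend {I : Set ℝ} {l u : ℝ} (hIcc : I ⊆ Set.Icc l u) {F : ℝ → ℝ}
    (hF : Continuous F) : ∃ C, ∀ s, |boundaryExtend I F s| ≤ C := by
  classical
  obtain ⟨C, hC⟩ := (isCompact_Icc (a := l) (b := u)).exists_bound_of_continuousOn hF.continuousOn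
  refine ⟨max C 1, fun s => ?_⟩
  unfold boundaryExtend
  split_ifs with h1 h2
  · exact (hC s (hIcc h1)).trans (le_max_left _ _)
  · simp
  · simp

/-- Averaging `boundaryExtend I F` over a jump: `U` and `D` are the averages of `F` over upward and
downward jumps, characterised by linear differential equations and boundary values. -/
lemma integral_boundaryExtend_jump (hp : 0 < p) (hq : 0 < q) (hb : 0 < b) (hc : 0 < c)
    {I : Set ℝ} (hI : MeasurableSet I) {l u : ℝ} (hIoo : Set.Ioo l u ⊆ I) (hIcc : I ⊆ Set.Icc l u)
    (h0 : (0 : ℝ) ∈ I) {F U D : ℝ → ℝ} (hF : Continuous F)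
    (hU : ∀ s, HasDerivAt U (c * (U s - F s)) s) (hD : ∀ s, HasDerivAt D (b * (F s - D s)) s)
    (hUu : U u = 1) (hDl : D l = 0) (hUD : ∀ s, p * U s + q * D s = F s) {s : ℝ} (hs : s ∈ I) :
    ∫ y, boundaryExtend I F (s + y) ∂(jumpLaw p q b c) = boundaryExtend I F s := by
  classical
  obtain ⟨C, hC⟩ := exists_bound_boundaryExtend hIcc hF
  have hm := measurable_boundaryExtend hI hF
  have := isProbabilityMeasure_expMeasure hc
  have := isProbabilityMeasure_expMeasure hb
  have hsI := hIcc hs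
  have h0I := hIcc h0
  rw [integral_jumpLaw hp hq hb hc (g := fun y => boundaryExtend I F (s + y))
    (hm.comp (measurable_const_add s)) (fun y => hC _)]
  rw [integral_expMeasure_eq_of_hasDerivAt (a := u - s) (K := 1) (f := fun y => F (s + y))
      (G := fun y => U (s + y)) hc (by linarith [hsI.2]),
    integral_expMeasure_eq_of_hasDerivAt (a := s - l) (K := 0) (f := fun y => F (s - y))
      (G := fun y => D (s - y)) hb (by linarith [hsI.1])]
  · simp [hUD, boundaryExtend, hs]
  · exact Integrable.of_bound (hm.comp (by fun_prop)).aestronglyMeasurable C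
      (Eventually.of_forall fun y => hC _)
  · fun_prop
  · intro y hy hy'
    have : s + -y ∈ I := hIoo ⟨by linarith, by linarith [hsI.2]⟩
    simp [boundaryExtend, this, sub_eq_add_neg]
  · intro y hy
    have h1 : s + -y ∉ I := fun h => by linarith [(hIcc h).1]
    have h2 : ¬ 0 < s + -y := fun h => by linarith [h0I.1]
    simp only [boundaryExtend, h1, h2, if_false]
  · intro y
    have := (hD (s - y)).comp y ((hasDerivAt_id y).const_sub s)
    exact this.congr_deriv (by ring)
  · simp [hDl]
  · exact Integrable.of_bound (hm.comp (by fun_prop)).aestronglyMeasurable C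
      (Eventually.of_forall fun y => hC _)
  · fun_prop
  · intro y hy hy'
    have : s + y ∈ I := hIoo ⟨by linarith [hsI.1], by linarith⟩
    simp [boundaryExtend, this]
  · intro y hy
    have h1 : s + y ∉ I := fun h => by linarith [(hIcc h).2]
    have h2 : 0 < s + y := by linarith [h0I.2]
    simp only [boundaryExtend, h1, h2, if_false, if_true]
  · intro y
    have := (hU (s + y)).comp y ((hasDerivAt_id y).const_add s)
    exact this.congr_deriv (by ring)
  · simp [hUu]

end JumpLaw

/-! ### Exit of a random walk from a bounded set. -/

section Walk

variable {Ω : Type*}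

/-- The random walk with steps `X k`. -/
noncomputable def walk (X : ℕ → Ω → ℝ) (n : ℕ) (ω : Ω) : ℝ := ∑ k ∈ Finset.range n, X k ω

/-- The walk is in `I` at the times `0, …, n`. -/
def stay (X : ℕ → Ω → ℝ) (I : Set ℝ) (n : ℕ) : Set Ω := {ω | ∀ k ≤ n, walk X k ω ∈ I}

/-- The walk is in `U` at some time, up to which it was in `I`. -/
def passage (X : ℕ → Ω → ℝ) (I U : Set ℝ) : Set Ω :=
  {ω | ∃ k, walk X k ω ∈ U ∧ ∀ j < k, walk X j ω ∈ I}

/-- The walk is in `U` at some time `k ≤ n`, up to which it was in `I`. -/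
def passageBy (X : ℕ → Ω → ℝ) (I U : Set ℝ) (n : ℕ) : Set Ω :=
  {ω | ∃ k ≤ n, walk X k ω ∈ U ∧ ∀ j < k, walk X j ω ∈ I}

@[simp] lemma walk_zero (X : ℕ → Ω → ℝ) (ω : Ω) : walk X 0 ω = 0 := by simp [walk]

lemma walk_succ (X : ℕ → Ω → ℝ) (n : ℕ) (ω : Ω) : walk X (n + 1) ω = walk X n ω + X n ω := by
  simp [walk, Finset.sum_range_succ]

lemma passage_eq_iUnion (X : ℕ → Ω → ℝ) (I U : Set ℝ) : passage X I U = ⋃ n, passageBy X I U n := by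
  ext ω
  simp only [passage, passageBy, Set.mem_ofPred_eq, Set.mem_iUnion]
  exact ⟨fun ⟨k, h⟩ => ⟨k, k, le_rfl, h⟩, fun ⟨_, k, _, h⟩ => ⟨k, h⟩⟩

variable [MeasurableSpace Ω] {μ : Measure Ω} {X : ℕ → Ω → ℝ} {I U : Set ℝ}

lemma measurable_walk (hX : ∀ k, Measurable (X k)) (n : ℕ) : Measurable (walk X n) :=
  Finset.measurable_fun_sum _ fun k _ => hX k

lemma measurableSet_stay (hX : ∀ k, Measurable (X k)) (hI : MeasurableSet I) (n : ℕ) :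
    MeasurableSet (stay X I n) := by
  simp only [stay, Set.ofPred_forall]
  exact .iInter fun k => .iInter fun _ => measurable_walk hX k hI

lemma measurableSet_passageBy (hX : ∀ k, Measurable (X k)) (hI : MeasurableSet I)
    (hU : MeasurableSet U) (n : ℕ) : MeasurableSet (passageBy X I U n) := by
  have : passageBy X I U n = ⋃ k, ⋃ (_ : k ≤ n), walk X k ⁻¹' U ∩ ⋂ j, ⋂ (_ : j < k),
      walk X j ⁻¹' I := by
    ext ω
    simp only [passageBy, Set.mem_ofPred_eq, Set.mem_iUnion, Set.mem_inter_iff, Set.mem_iInter,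
      Set.mem_preimage, exists_prop]
  rw [this]
  exact .iUnion fun k => .iUnion fun _ => (measurable_walk hX k hU).inter
    (.iInter fun j => .iInter fun _ => measurable_walk hX j hI)

lemma measurableSet_passage (hX : ∀ k, Measurable (X k)) (hI : MeasurableSet I)
    (hU : MeasurableSet U) : MeasurableSet (passage X I U) := by
  rw [passage_eq_iUnion]
  exact .iUnion fun n => measurableSet_passageBy hX hI hU n

/-- The past of a sequence of independent variables is independent of the next one. -/
lemma indepFun_truncated (hX : ∀ k, Measurable (X k)) (hind : iIndepFun X μ) (n : ℕ) :
    IndepFun (fun ω i => if i < n then X i ω else 0) (X n) μ := by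
  have h := hind.indepFun_finset (Finset.range n) {n} (by simp) hX
  have h1 : Measurable (fun (v : Finset.range n → ℝ) (i : ℕ) =>
      if h : i < n then v ⟨i, Finset.mem_range.2 h⟩ else 0) := by
    refine measurable_pi_lambda _ fun i => ?_
    by_cases hi : i < n
    · simp only [hi, dite_true]; fun_prop
    · simp only [hi, dite_false]; fun_prop
  have h2 : Measurable (fun v : ({n} : Finset ℕ) → ℝ => v ⟨n, by simp⟩) := by fun_prop
  convert h.comp h1 h2 using 1
  · ext ω i
    by_cases hi : i < n <;> simp [hi]
  · rfl

/-- Both components depend only on the first `n` steps, so they are unchanged when computed from the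
truncated sequence, which is independent of `X n`. -/
lemma indepFun_stay_walk (hX : ∀ k, Measurable (X k)) (hind : iIndepFun X μ)
    (hI : MeasurableSet I) (n : ℕ) :
    IndepFun (fun ω => ((stay X I n).indicator (fun _ => (1 : ℝ)) ω, walk X n ω)) (X n) μ := by
  have h := indepFun_truncated hX hind n
  let Y : ℕ → (ℕ → ℝ) → ℝ := fun i v => v i
  have hY : ∀ i, Measurable (Y i) := fun i => measurable_pi_apply i
  have h1 : Measurable fun v => ((stay Y I n).indicator (fun _ => (1 : ℝ)) v, walk Y n v) :=
    (measurable_const.indicator (measurableSet_stay hY hI n)).prodMk (measurable_walk hY n)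
  have h2 := h.comp h1 measurable_id
  have hw : ∀ k ≤ n, ∀ ω, walk Y k (fun i => if i < n then X i ω else 0) = walk X k ω := by
    intro k hk ω
    refine Finset.sum_congr rfl fun i hi => ?_
    have : i < n := (Finset.mem_range.1 hi).trans_le hk
    simp [Y, this]
  convert h2 using 1
  swap
  · rfl
  ext ω
  · classical
    simp only [Function.comp, Set.indicator]
    congr 1
    simp only [stay, Set.mem_ofPred_eq, eq_iff_iff]
    exact forall₂_congr fun k hk => by rw [hw k hk]
  · simp [hw n le_rfl]

/-- The martingale step: the event is decided before the step `X n`, so Fubini averages that step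
out, and on the event the walk is at a point of `I`, where `h` is harmonic. -/
lemma setIntegral_stay_walk_succ [IsProbabilityMeasure μ] {J : Measure ℝ}
    (hX : ∀ k, Measurable (X k)) (hind : iIndepFun X μ) (hJ : ∀ k, μ.map (X k) = J)
    (hI : MeasurableSet I) {h : ℝ → ℝ} (hm : Measurable h) {C : ℝ} (hC : ∀ s, |h s| ≤ C)
    (hh : ∀ s ∈ I, ∫ y, h (s + y) ∂J = h s) (n : ℕ) :
    ∫ ω in stay X I n, h (walk X (n + 1) ω) ∂μ = ∫ ω in stay X I n, h (walk X n ω) ∂μ := by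
  have hJp : IsProbabilityMeasure J := by
    rw [← hJ 0]; exact Measure.isProbabilityMeasure_map (hX 0).aemeasurable
  set Y : Ω → ℝ × ℝ := fun ω => ((stay X I n).indicator (fun _ => (1 : ℝ)) ω, walk X n ω)
  have hs := measurableSet_stay (I := I) hX hI n
  have hY : Measurable Y := (measurable_const.indicator hs).prodMk (measurable_walk hX n)
  have hYp : IsProbabilityMeasure (μ.map Y) := Measure.isProbabilityMeasure_map hY.aemeasurable
  have hlaw := (indepFun_iff_map_prod_eq_prod_map_map hY.aemeasurable (hX n).aemeasurable).1
    (indepFun_stay_walk hX hind hI n)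
  rw [hJ n] at hlaw
  have hg : Measurable fun z : (ℝ × ℝ) × ℝ => z.1.1 * h (z.1.2 + z.2) :=
    (by fun_prop : Measurable fun z : (ℝ × ℝ) × ℝ => z.1.1).mul (hm.comp (by fun_prop))
  have hbd : ∀ ω, ‖(Y ω).1 * h ((Y ω).2 + X n ω)‖ ≤ C := by
    intro ω
    have hC' := hC ((Y ω).2 + X n ω)
    rw [Real.norm_eq_abs, abs_mul]
    by_cases hω : ω ∈ stay X I n
    · simpa [Y, hω] using hC'
    · simpa [Y, hω] using (abs_nonneg _).trans hC'
  have hpair : Measurable fun ω => (Y ω, X n ω) := hY.prodMk (hX n)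
  have hint : Integrable (fun z : (ℝ × ℝ) × ℝ => z.1.1 * h (z.1.2 + z.2)) ((μ.map Y).prod J) := by
    rw [← hlaw, integrable_map_measure hg.aestronglyMeasurable hpair.aemeasurable]
    exact Integrable.of_bound (hg.comp hpair).aestronglyMeasurable C (Eventually.of_forall hbd)
  calc ∫ ω in stay X I n, h (walk X (n + 1) ω) ∂μ
      = ∫ ω, (Y ω).1 * h ((Y ω).2 + X n ω) ∂μ := by
        rw [← integral_indicator hs]
        refine integral_congr_ae (Eventually.of_forall fun ω => ?_)
        by_cases hω : ω ∈ stay X I n <;> simp [Y, hω, walk_succ]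
    _ = ∫ z, z.1.1 * h (z.1.2 + z.2) ∂((μ.map Y).prod J) := by
        rw [← hlaw, integral_map hpair.aemeasurable hg.aestronglyMeasurable]
    _ = ∫ v, v.1 * ∫ y, h (v.2 + y) ∂J ∂(μ.map Y) := by
        rw [integral_prod _ hint]
        simp [integral_const_mul]
    _ = ∫ ω, (Y ω).1 * ∫ y, h ((Y ω).2 + y) ∂J ∂μ := by
        rw [integral_map hY.aemeasurable]
        refine (measurable_fst.mul ?_).aestronglyMeasurable
        exact (StronglyMeasurable.integral_prod_right
          (f := fun (v : ℝ × ℝ) y => h (v.2 + y))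
          (hm.comp (by fun_prop)).stronglyMeasurable).measurable
    _ = ∫ ω in stay X I n, h (walk X n ω) ∂μ := by
        rw [← integral_indicator hs]
        refine integral_congr_ae (Eventually.of_forall fun ω => ?_)
        by_cases hω : ω ∈ stay X I n
        · simp [Y, hω, hh _ (hω n le_rfl)]
        · simp [Y, hω]

/-- Optional stopping at time `n`: the mean of `h` along the stopped walk is constant. Paths stopped
in `U` contribute `1`, those stopped elsewhere `0`, and the integral accounts for those still in
`I`. -/
lemma measureReal_passageBy_add [IsProbabilityMeasure μ] {J : Measure ℝ}
    (hX : ∀ k, Measurable (X k)) (hind : iIndepFun X μ) (hJ : ∀ k, μ.map (X k) = J)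
    (hI : MeasurableSet I) (hU : MeasurableSet U) (hUI : Disjoint U I) (h0 : (0 : ℝ) ∈ I)
    {h : ℝ → ℝ} (hm : Measurable h) {C : ℝ} (hC : ∀ s, |h s| ≤ C)
    (hh : ∀ s ∈ I, ∫ y, h (s + y) ∂J = h s) (hhU : ∀ s ∈ U, h s = 1)
    (hh0 : ∀ s, s ∉ I → s ∉ U → h s = 0) (n : ℕ) :
    μ.real (passageBy X I U n) + ∫ ω in stay X I n, h (walk X n ω) ∂μ = h 0 := by
  induction n with
  | zero =>
    have h1 : passageBy X I U 0 = ∅ := by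
      ext ω
      simp only [passageBy, Nat.le_zero, Set.mem_ofPred_eq, Set.mem_empty_iff_false, iff_false]
      rintro ⟨k, rfl, hk, -⟩
      rw [walk_zero] at hk
      exact Set.disjoint_left.1 hUI hk h0
    have h2 : stay X I 0 = Set.univ := by
      ext ω; simp [stay, h0]
    simp [h1, h2]
  | succ n ih =>
    have hsn := measurableSet_stay (I := I) hX hI n
    have hwI := measurable_walk hX (n + 1) hI
    have hwU := measurable_walk hX (n + 1) hU
    have hint : Integrable (fun ω => h (walk X (n + 1) ω)) μ :=
      Integrable.of_bound (hm.comp (measurable_walk hX _)).aestronglyMeasurable C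
        (Eventually.of_forall fun ω => hC _)
    have e1 : passageBy X I U (n + 1)
        = passageBy X I U n ∪ (stay X I n ∩ walk X (n + 1) ⁻¹' U) := by
      ext ω
      simp only [passageBy, stay, Set.mem_union, Set.mem_ofPred_eq, Set.mem_inter_iff,
        Set.mem_preimage]
      constructor
      · rintro ⟨k, hk, h1, h2⟩
        rcases Nat.lt_or_ge n k with h | h
        · obtain rfl : k = n + 1 := by omega
          exact Or.inr ⟨fun j hj => h2 j (by omega), h1⟩
        · exact Or.inl ⟨k, h, h1, h2⟩
      · rintro (⟨k, hk, h1, h2⟩ | ⟨h1, h2⟩)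
        · exact ⟨k, by omega, h1, h2⟩
        · exact ⟨n + 1, le_rfl, h2, fun j hj => h1 j (by omega)⟩
    have hdisj : Disjoint (passageBy X I U n) (stay X I n ∩ walk X (n + 1) ⁻¹' U) := by
      rw [Set.disjoint_left]
      rintro ω ⟨k, hk, h1, -⟩ ⟨h2, -⟩
      exact Set.disjoint_left.1 hUI h1 (h2 k hk)
    have e2 : stay X I (n + 1) = stay X I n ∩ walk X (n + 1) ⁻¹' I := by
      ext ω
      simp only [stay, Set.mem_ofPred_eq, Set.mem_inter_iff, Set.mem_preimage]
      constructor
      · exact fun h => ⟨fun k hk => h k (by omega), h _ le_rfl⟩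
      · rintro ⟨h1, h2⟩ k hk
        rcases Nat.lt_or_ge n k with h | h
        · obtain rfl : k = n + 1 := by omega
          exact h2
        · exact h1 k h
    have e3 : ∫ ω in stay X I n \ walk X (n + 1) ⁻¹' I, h (walk X (n + 1) ω) ∂μ
        = μ.real (stay X I n ∩ walk X (n + 1) ⁻¹' U) := by
      rw [← integral_indicator_one (hsn.inter hwU), ← integral_indicator (hsn.diff hwI)]
      refine integral_congr_ae (Eventually.of_forall fun ω => ?_)
      simp only [Set.indicator, Set.mem_sdiff, Set.mem_inter_iff, Set.mem_preimage, Pi.one_apply]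
      by_cases h1 : ω ∈ stay X I n
      · by_cases h2 : walk X (n + 1) ω ∈ U
        · have h3 := Set.disjoint_left.1 hUI h2
          simp [h1, h2, h3, hhU _ h2]
        · by_cases h3 : walk X (n + 1) ω ∈ I
          · simp [h2, h3]
          · simp [h1, h2, h3, hh0 _ h3 h2]
      · simp [h1]
    have e4 := integral_inter_add_sdiff (s := stay X I n) hwI hint.integrableOn
    rw [e3, ← e2, setIntegral_stay_walk_succ hX hind hJ hI hm hC hh n] at e4
    rw [e1, measureReal_union hdisj (hsn.inter hwU)]
    linarith

/-- Independent events of a fixed positive probability happen infinitely often. -/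
lemma ae_frequently_lt [IsProbabilityMeasure μ] {Y : ℕ → Ω → ℝ} {J : Measure ℝ}
    (hY : ∀ k, Measurable (Y k)) (hind : iIndepFun Y μ) (hJ : ∀ k, μ.map (Y k) = J) {a : ℝ}
    (ha : 0 < J (Set.Ioi a)) : ∀ᵐ ω ∂μ, ∃ᶠ k in atTop, a < Y k ω := by
  have hs : ∀ k, MeasurableSet (Y k ⁻¹' Set.Ioi a) := fun k => hY k measurableSet_Ioi
  have h := measure_limsup_eq_one (μ := μ) hs ?_ ?_
  · rw [← prob_compl_eq_zero_iff (MeasurableSet.measurableSet_limsup hs)] at h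
    rw [ae_iff]
    convert h using 2
    ext ω
    simp [mem_limsup_iff_frequently_mem]
  · rw [iIndepSet_iff_meas_biInter hs]
    intro S
    exact hind.measure_inter_preimage_eq_mul S (fun _ _ => measurableSet_Ioi)
  · have : ∀ k, μ (Y k ⁻¹' Set.Ioi a) = J (Set.Ioi a) := fun k => by
      rw [← hJ k, Measure.map_apply (hY k) measurableSet_Ioi]
    simp [this, ENNReal.tsum_const_eq_top_of_ne_zero ha.ne']

/-- A jump longer than `u - l` cannot start and end in `I`, and almost surely one occurs. -/
lemma ae_exists_walk_notMem [IsProbabilityMeasure μ] {J : Measure ℝ}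
    (hX : ∀ k, Measurable (X k)) (hind : iIndepFun X μ) (hJ : ∀ k, μ.map (X k) = J)
    {l u : ℝ} (hIcc : I ⊆ Set.Icc l u) (ha : 0 < J (Set.Ioi (u - l))) :
    ∀ᵐ ω ∂μ, ∃ k, walk X k ω ∉ I := by
  filter_upwards [ae_frequently_lt hX hind hJ ha] with ω hω
  obtain ⟨k, hk⟩ := hω.exists
  by_contra! hcon
  have h1 := hIcc (hcon k)
  have h2 := hIcc (hcon (k + 1))
  rw [walk_succ] at h2
  linarith [h1.1, h2.2]

/-- The probability of leaving `I` into `U` is the value at the starting point of the bounded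
function harmonic on `I` with boundary values `1` on `U` and `0` elsewhere. -/
lemma measureReal_passage_eq [IsProbabilityMeasure μ] {J : Measure ℝ}
    (hX : ∀ k, Measurable (X k)) (hind : iIndepFun X μ) (hJ : ∀ k, μ.map (X k) = J)
    (hI : MeasurableSet I) (hU : MeasurableSet U) (hUI : Disjoint U I) (h0 : (0 : ℝ) ∈ I)
    {h : ℝ → ℝ} (hm : Measurable h) {C : ℝ} (hC : ∀ s, |h s| ≤ C)
    (hh : ∀ s ∈ I, ∫ y, h (s + y) ∂J = h s) (hhU : ∀ s ∈ U, h s = 1)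
    (hh0 : ∀ s, s ∉ I → s ∉ U → h s = 0) (hexit : ∀ᵐ ω ∂μ, ∃ k, walk X k ω ∉ I) :
    μ.real (passage X I U) = h 0 := by
  have h1 : Tendsto (fun n => μ.real (passageBy X I U n)) atTop (𝓝 (μ.real (passage X I U))) := by
    rw [passage_eq_iUnion]
    refine (ENNReal.tendsto_toReal (measure_ne_top _ _)).comp (tendsto_measure_iUnion_atTop ?_)
    rintro m n hmn ω ⟨k, hk, hk'⟩
    exact ⟨k, hk.trans hmn, hk'⟩
  -- The walk almost surely leaves `I`, so the integrand is eventually zero, and `h` is bounded.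
  have h2 : Tendsto (fun n => ∫ ω in stay X I n, h (walk X n ω) ∂μ) atTop (𝓝 0) := by
    have h3 : Tendsto (fun n => ∫ ω, (stay X I n).indicator (fun ω => h (walk X n ω)) ω ∂μ) atTop
        (𝓝 (∫ _, (0 : ℝ) ∂μ)) := by
      refine tendsto_integral_of_dominated_convergence (fun _ => C) ?_ (integrable_const C) ?_ ?_
      · exact fun n => ((hm.comp (measurable_walk hX n)).indicator
          (measurableSet_stay hX hI n)).aestronglyMeasurable
      · refine fun n => Eventually.of_forall fun ω => ?_
        exact (norm_indicator_le_norm_self _ ω).trans (hC _)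
      · filter_upwards [hexit] with ω ⟨k, hk⟩
        refine tendsto_const_nhds.congr' ?_
        filter_upwards [eventually_ge_atTop k] with n hn
        rw [Set.indicator_of_notMem]
        exact fun hs => hk (hs k hn)
    simpa [integral_indicator (measurableSet_stay hX hI _)] using h3
  have h4 := h1.add h2
  simp only [measureReal_passageBy_add hX hind hJ hI hU hUI h0 hm hC hh hhU hh0, add_zero] at h4
  exact tendsto_nhds_unique h4 tendsto_const_nhds

end Walk

/-! ### Paths of the process in terms of the two walks. -/

section Path

variable {Ω : Type*} {ζ X : ℕ → Ω → ℝ} {ω : Ω}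

/-- The waiting times at `ω` are positive and their sums are unbounded. -/
def RegularAt (ζ : ℕ → Ω → ℝ) (ω : Ω) : Prop :=
  (∀ k, 0 < ζ k ω) ∧ ∀ t, ∃ n, t < walk ζ n ω

lemma RegularAt.strictMono (h : RegularAt ζ ω) : StrictMono fun n => walk ζ n ω :=
  strictMono_nat_of_lt_succ fun n => by simpa [walk_succ] using h.1 n

lemma RegularAt.exists_between (h : RegularAt ζ ω) {t : ℝ} (ht : 0 ≤ t) :
    ∃ n, walk ζ n ω ≤ t ∧ t < walk ζ (n + 1) ω := by
  classical
  have hex := h.2 t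
  have h1 := Nat.find_spec hex
  have h0 : Nat.find hex ≠ 0 := by
    intro h0
    rw [h0, walk_zero] at h1
    linarith
  obtain ⟨n, hn⟩ := Nat.exists_eq_succ_of_ne_zero h0
  refine ⟨n, not_lt.1 (Nat.find_min hex (by omega)), ?_⟩
  rwa [hn] at h1

lemma RegularAt.path_eq (h : RegularAt ζ ω) {t : ℝ} {n : ℕ} (h1 : walk ζ n ω ≤ t)
    (h2 : t < walk ζ (n + 1) ω) : path ζ X t ω = walk X n ω := by
  have hset : {k : ℕ | arrival ζ k ω ≤ t} = Set.Iio n := by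
    ext k
    -- Arrivals are numbered from `0`, so the arrival number `k` is the partial sum of `k + 1`
    -- waiting times.
    change walk ζ (k + 1) ω ≤ t ↔ k < n
    constructor
    · intro hk
      by_contra! hn
      have : walk ζ (n + 1) ω ≤ walk ζ (k + 1) ω :=
        h.strictMono.monotone (show n + 1 ≤ k + 1 by omega)
      linarith
    · intro hk
      exact (h.strictMono.monotone (show k + 1 ≤ n by omega)).trans h1
  have hc : count ζ t ω = n := by
    rw [count, hset, ← Finset.coe_Iio, Set.ncard_coe_finset, Nat.card_Iio]
  rw [path, hc, walk]

lemma RegularAt.path_walk (h : RegularAt ζ ω) (n : ℕ) :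
    path ζ X (walk ζ n ω) ω = walk X n ω :=
  h.path_eq le_rfl (h.strictMono n.lt_succ_self)

lemma RegularAt.image_path (h : RegularAt ζ ω) {t : ℝ} :
    (fun u => path ζ X u ω) '' Set.Icc 0 t = (fun k => walk X k ω) '' {k | walk ζ k ω ≤ t} := by
  ext v
  constructor
  · rintro ⟨u, hu, rfl⟩
    obtain ⟨n, h1, h2⟩ := h.exists_between hu.1
    exact ⟨n, h1.trans hu.2, (h.path_eq h1 h2).symm⟩
  · rintro ⟨n, hn, rfl⟩
    refine ⟨walk ζ n ω, ⟨?_, hn⟩, h.path_walk n⟩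
    simpa using h.strictMono.monotone (Nat.zero_le n)

lemma RegularAt.finite_walk_le (h : RegularAt ζ ω) (t : ℝ) : {k | walk ζ k ω ≤ t}.Finite := by
  obtain ⟨n, hn⟩ := h.2 t
  refine (Set.finite_Iio n).subset fun k hk => ?_
  exact h.strictMono.lt_iff_lt.1 (lt_of_le_of_lt hk hn)

/-- The path starts at `0`, so its infimum is at most `0`. Only finitely many values are taken up to
`t`, so the real infimum is a genuine one and not a default value. -/
lemma RegularAt.runInf_eq_zero_iff (h : RegularAt ζ ω) {t : ℝ} (ht : 0 ≤ t) :
    runInf ζ X t ω = 0 ↔ ∀ k, walk ζ k ω ≤ t → 0 ≤ walk X k ω := by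
  rw [runInf, h.image_path]
  constructor
  · intro h0 k hk
    rw [← h0]
    exact csInf_le ((h.finite_walk_le t).image _).bddBelow ⟨k, hk, rfl⟩
  · intro hk
    refine IsLeast.csInf_eq ⟨⟨0, by simpa using ht, by simp⟩, ?_⟩
    rintro _ ⟨k, hk', rfl⟩
    exact hk k hk'

/-- The path changes only at arrivals, so it leaves when the walk does. `N ≠ 0` makes this time
positive, as the infimum runs over `t > 0`. -/
lemma RegularAt.exitTime_eq (h : RegularAt ζ ω) {x T : ℝ} {N : ℕ} (hN : N ≠ 0)
    (hNI : walk X N ω ∉ Set.Ioo (x - T) x) (hj : ∀ j < N, walk X j ω ∈ Set.Ioo (x - T) x) :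
    exitTime ζ X x T ω = ENNReal.ofReal (walk ζ N ω) := by
  have hpos : 0 < walk ζ N ω := by
    simpa using h.strictMono (Nat.pos_of_ne_zero hN)
  refine IsLeast.csInf_eq ⟨⟨_, ⟨hpos, by rwa [h.path_walk]⟩, rfl⟩, ?_⟩
  rintro _ ⟨t, ⟨ht, hp⟩, rfl⟩
  refine ENNReal.ofReal_le_ofReal ?_
  by_contra! hlt
  obtain ⟨n, h1, h2⟩ := h.exists_between ht.le
  rw [h.path_eq h1 h2] at hp
  exact hp (hj n (h.strictMono.lt_iff_lt.1 (h1.trans_lt hlt)))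

lemma exists_first_exit {I : Set ℝ} (h0 : (0 : ℝ) ∈ I) (hex : ∃ k, walk X k ω ∉ I) :
    ∃ N, N ≠ 0 ∧ walk X N ω ∉ I ∧ ∀ j < N, walk X j ω ∈ I := by
  classical
  refine ⟨Nat.find hex, ?_, Nat.find_spec hex, fun j hj => not_not.1 (Nat.find_min hex hj)⟩
  intro hz
  have := Nat.find_spec hex
  rw [hz, walk_zero] at this
  exact this h0

lemma mem_passage_iff_of_first_exit {I U : Set ℝ} (hUI : Disjoint U I) {N : ℕ}
    (hN : walk X N ω ∉ I) (hj : ∀ j < N, walk X j ω ∈ I) :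
    ω ∈ passage X I U ↔ walk X N ω ∈ U := by
  constructor
  · rintro ⟨k, hk, hkj⟩
    rcases lt_trichotomy k N with h | rfl | h
    · exact (Set.disjoint_left.1 hUI hk (hj k h)).elim
    · exact hk
    · exact (hN (hkj N h)).elim
  · exact fun h => ⟨N, h, hj⟩

lemma RegularAt.mem_exitUp_iff (h : RegularAt ζ ω) {x T : ℝ} (hx : 0 < x) (hxT : x < T)
    (hex : ∃ k, walk X k ω ∉ Set.Ioo (x - T) x) :
    ω ∈ exitUp ζ X x T ↔ ω ∈ passage X (Set.Ioo (x - T) x) (Set.Ici x) := by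
  obtain ⟨N, hN, hNI, hj⟩ := exists_first_exit (by constructor <;> linarith) hex
  have hpos : 0 ≤ walk ζ N ω := by simpa using h.strictMono.monotone (Nat.zero_le N)
  have hdisj : Disjoint (Set.Ici x) (Set.Ioo (x - T) x) :=
    Set.disjoint_left.2 fun s h1 h2 => not_lt.2 h1 h2.2
  rw [mem_passage_iff_of_first_exit hdisj hNI hj]
  change exitTime ζ X x T ω < ∞ ∧ x ≤ path ζ X (exitTime ζ X x T ω).toReal ω ↔ x ≤ walk X N ω
  rw [h.exitTime_eq hN hNI hj, ENNReal.toReal_ofReal hpos, h.path_walk]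
  simp

lemma RegularAt.mem_exitDown_iff (h : RegularAt ζ ω) {x T : ℝ} (hx : 0 < x) (hxT : x < T)
    (hex : ∃ k, walk X k ω ∉ Set.Ioo (x - T) x) :
    ω ∈ exitDown ζ X x T ↔ ω ∉ passage X (Set.Ioo (x - T) x) (Set.Ici x) := by
  obtain ⟨N, hN, hNI, hj⟩ := exists_first_exit (by constructor <;> linarith) hex
  have hpos : 0 ≤ walk ζ N ω := by simpa using h.strictMono.monotone (Nat.zero_le N)
  have hdisj : Disjoint (Set.Ici x) (Set.Ioo (x - T) x) :=
    Set.disjoint_left.2 fun s h1 h2 => not_lt.2 h1 h2.2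
  rw [mem_passage_iff_of_first_exit hdisj hNI hj]
  change exitTime ζ X x T ω < ∞ ∧ path ζ X (exitTime ζ X x T ω).toReal ω ≤ x - T
    ↔ ¬ x ≤ walk X N ω
  rw [h.exitTime_eq hN hNI hj, ENNReal.toReal_ofReal hpos, h.path_walk]
  simp only [ENNReal.ofReal_lt_top, true_and, not_le]
  constructor
  · intro h1; linarith
  · intro h1
    by_contra! h2
    exact hNI ⟨h2, h1⟩

/-- Serves measurability: the exit time is an almost sure limit of measurable sums, each waiting
time being counted while the walk is still inside. -/
lemma RegularAt.tendsto_exitTime (h : RegularAt ζ ω) {x T : ℝ} (hx : 0 < x) (hxT : x < T)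
    (hex : ∃ k, walk X k ω ∉ Set.Ioo (x - T) x) :
    Tendsto (fun n => ∑ k ∈ Finset.range n, (stay X (Set.Ioo (x - T) x) k).indicator (ζ k) ω) atTop
      (𝓝 (exitTime ζ X x T ω).toReal) := by
  obtain ⟨N, hN, hNI, hj⟩ := exists_first_exit (by constructor <;> linarith) hex
  have hpos : 0 ≤ walk ζ N ω := by simpa using h.strictMono.monotone (Nat.zero_le N)
  rw [h.exitTime_eq hN hNI hj, ENNReal.toReal_ofReal hpos]
  refine tendsto_const_nhds.congr' ?_
  filter_upwards [eventually_ge_atTop N] with n hn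
  rw [walk, ← Finset.sum_subset (Finset.range_mono hn)]
  · refine Finset.sum_congr rfl fun k hk => ?_
    rw [Set.indicator_of_mem]
    exact fun j hjk => hj j (hjk.trans_lt (Finset.mem_range.1 hk))
  · intro k _ hk
    rw [Set.indicator_of_notMem]
    exact fun hs => hNI (hs N (by simpa using hk))

end Path

/-! ### Reflection. -/

lemma pPlus_eq_pMinus_neg {Ω : Type*} [MeasurableSpace Ω] (μ : Measure Ω) (ζ X : ℕ → Ω → ℝ) :
    pPlus μ ζ X = pMinus μ ζ (fun k ω => -X k ω) := by
  have hpath : ∀ t ω, path ζ (fun k ω => -X k ω) t ω = -path ζ X t ω := fun t ω => by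
    simp [path]
  have h : ∀ t ω, runInf ζ (fun k ω => -X k ω) t ω = -runSup ζ X t ω := fun t ω => by
    simp only [runInf, runSup, hpath]
    -- The real infimum is defined as minus the supremum of the opposite set, so no boundedness is
    -- needed.
    rw [Real.sInf_def, ← Set.image_neg_eq_neg, Set.image_image]
    simp
  ext s
  simp [pPlus, pMinus, h]

/-- The reflected process. -/
lemma IsInput.neg {Ω : Type*} [MeasurableSpace Ω] {μ : Measure Ω} {lam p q b c : ℝ}
    {ζ X : ℕ → Ω → ℝ} (hξ : IsInput μ lam p q b c ζ X) :
    IsInput μ lam q p c b ζ (fun k ω => -X k ω) where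
  measurable_wait := hξ.measurable_wait
  measurable_jump k := (hξ.measurable_jump k).neg
  law_wait := hξ.law_wait
  law_jump k := by
    rw [← jumpLaw_map_neg, ← hξ.law_jump k,
      Measure.map_map (by fun_prop) (hξ.measurable_jump k)]
    rfl
  indep_wait := hξ.indep_wait
  indep_jump := hξ.indep_jump.comp (fun _ y => -y) (fun _ => measurable_neg)
  indep_wait_jump := by
    have hm : Measurable fun (v : ℕ → ℝ) k => -v k := by fun_prop
    exact hξ.indep_wait_jump.comp measurable_id hm

/-! ### Almost sure properties and the limits as `s ↓ 0`. -/

section Probability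

variable {Ω : Type*} [MeasurableSpace Ω] {μ : Measure Ω} [IsProbabilityMeasure μ]
  {lam p q b c : ℝ} {ζ X : ℕ → Ω → ℝ}

lemma IsInput.ae_regularAt (hξ : IsInput μ lam p q b c ζ X) (hlam : 0 < lam) :
    ∀ᵐ ω ∂μ, RegularAt ζ ω := by
  have h1 : ∀ᵐ ω ∂μ, ∀ k, 0 < ζ k ω := by
    rw [ae_all_iff]
    intro k
    have := ae_expMeasure_pos hlam
    rw [← hξ.law_wait k] at this
    exact ae_of_ae_map (hξ.measurable_wait k).aemeasurable this
  filter_upwards [h1, ae_frequently_lt hξ.measurable_wait hξ.indep_wait hξ.law_wait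
    (expMeasure_Ioi_pos hlam 1)] with ω hω hf
  refine ⟨hω, fun t => ?_⟩
  have hmono : Monotone fun n => walk ζ n ω :=
    monotone_nat_of_le_succ fun n => by simpa [walk_succ] using (hω n).le
  have hN : ∀ m : ℕ, ∃ n, (m : ℝ) ≤ walk ζ n ω := by
    intro m
    induction m with
    | zero => exact ⟨0, by simp⟩
    | succ m ih =>
      obtain ⟨n, hn⟩ := ih
      obtain ⟨k, hk, hk'⟩ := frequently_atTop.1 hf n
      refine ⟨k + 1, ?_⟩
      have : walk ζ n ω ≤ walk ζ k ω := hmono hk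
      rw [walk_succ]
      push_cast
      linarith
  obtain ⟨m, hm⟩ := exists_nat_gt t
  obtain ⟨n, hn⟩ := hN m
  exact ⟨n, hm.trans_le hn⟩

lemma IsInput.ae_exists_exit (hξ : IsInput μ lam p q b c ζ X) (hp : 0 < p) (hc : 0 < c)
    {I : Set ℝ} {l u : ℝ} (hIcc : I ⊆ Set.Icc l u) : ∀ᵐ ω ∂μ, ∃ k, walk X k ω ∉ I :=
  ae_exists_walk_notMem hξ.measurable_jump hξ.indep_jump hξ.law_jump hIcc (jumpLaw_Ioi_pos hp hc _)

lemma IsInput.aemeasurable_exitTime (hξ : IsInput μ lam p q b c ζ X) (hlam : 0 < lam) (hp : 0 < p)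
    (hc : 0 < c) {x T : ℝ} (hx : 0 < x) (hxT : x < T) :
    AEMeasurable (fun ω => (exitTime ζ X x T ω).toReal) μ := by
  refine aemeasurable_of_tendsto_metrizable_ae atTop (f := fun n ω => ∑ k ∈ Finset.range n,
    (stay X (Set.Ioo (x - T) x) k).indicator (ζ k) ω) (fun n => ?_) ?_
  · exact (Finset.measurable_fun_sum _ fun k _ => (hξ.measurable_wait k).indicator
      (measurableSet_stay hξ.measurable_jump measurableSet_Ioo k)).aemeasurable
  · filter_upwards [hξ.ae_regularAt hlam,
      hξ.ae_exists_exit hp hc (Set.Ioo_subset_Icc_self (a := x - T) (b := x))] with ω h1 h2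
    exact h1.tendsto_exitTime hx hxT h2

lemma tendsto_setIntegral_exp_neg_mul {τ : Ω → ℝ} (hτ : AEMeasurable τ μ) (hτ0 : ∀ ω, 0 ≤ τ ω)
    (A : Set Ω) :
    Tendsto (fun s => ∫ ω in A, Real.exp (-s * τ ω) ∂μ) (𝓝[>] 0) (𝓝 (μ.real A)) := by
  have h : Tendsto (fun s => ∫ ω in A, Real.exp (-s * τ ω) ∂μ) (𝓝[>] 0)
      (𝓝 (∫ _ in A, (1 : ℝ) ∂μ)) := by
    refine tendsto_integral_filter_of_dominated_convergence (fun _ => 1) ?_ ?_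
      (integrable_const _) ?_
    · refine Eventually.of_forall fun s => ?_
      exact (Real.measurable_exp.comp_aemeasurable
        (hτ.restrict.const_mul (-s))).aestronglyMeasurable
    · filter_upwards [self_mem_nhdsWithin] with s hs
      refine Eventually.of_forall fun ω => ?_
      rw [Real.norm_eq_abs, Real.abs_exp, Real.exp_le_one_iff]
      nlinarith [hτ0 ω, Set.mem_Ioi.1 hs]
    · refine Eventually.of_forall fun ω => ?_
      have : Continuous fun s : ℝ => Real.exp (-s * τ ω) := by fun_prop
      simpa using (this.tendsto 0).mono_left nhdsWithin_le_nhds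
  simpa using h

lemma IsInput.measureReal_exitUp (hξ : IsInput μ lam p q b c ζ X) (hlam : 0 < lam) (hp : 0 < p)
    (hc : 0 < c) {x T : ℝ} (hx : 0 < x) (hxT : x < T) :
    μ.real (exitUp ζ X x T) = μ.real (passage X (Set.Ioo (x - T) x) (Set.Ici x)) := by
  refine measureReal_congr ?_
  filter_upwards [hξ.ae_regularAt hlam,
    hξ.ae_exists_exit hp hc (Set.Ioo_subset_Icc_self (a := x - T) (b := x))] with ω h1 h2
  exact propext (h1.mem_exitUp_iff hx hxT h2)

/-- Exit is almost sure, so exit below is the complement of exit above. -/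
lemma IsInput.measureReal_exitDown (hξ : IsInput μ lam p q b c ζ X) (hlam : 0 < lam) (hp : 0 < p)
    (hc : 0 < c) {x T : ℝ} (hx : 0 < x) (hxT : x < T) :
    μ.real (exitDown ζ X x T) = 1 - μ.real (passage X (Set.Ioo (x - T) x) (Set.Ici x)) := by
  rw [← probReal_compl_eq_one_sub
    (measurableSet_passage hξ.measurable_jump measurableSet_Ioo measurableSet_Ici)]
  refine measureReal_congr ?_
  filter_upwards [hξ.ae_regularAt hlam,
    hξ.ae_exists_exit hp hc (Set.Ioo_subset_Icc_self (a := x - T) (b := x))] with ω h1 h2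
  exact propext (h1.mem_exitDown_iff hx hxT h2)

lemma IsInput.upProbEq (hξ : IsInput μ lam p q b c ζ X) (hlam : 0 < lam) (hp : 0 < p)
    (hc : 0 < c) {x T v : ℝ} (hx : 0 < x) (hxT : x < T)
    (hv : μ.real (passage X (Set.Ioo (x - T) x) (Set.Ici x)) = v) : UpProbEq μ ζ X T x v := by
  have h := hξ.measureReal_exitUp hlam hp hc hx hxT
  refine ⟨?_, h.trans hv⟩
  rw [← hv, ← h]
  exact tendsto_setIntegral_exp_neg_mul (hξ.aemeasurable_exitTime hlam hp hc hx hxT)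
    (fun _ => ENNReal.toReal_nonneg) _

lemma IsInput.downProbEq (hξ : IsInput μ lam p q b c ζ X) (hlam : 0 < lam) (hp : 0 < p)
    (hc : 0 < c) {x T v : ℝ} (hx : 0 < x) (hxT : x < T)
    (hv : 1 - μ.real (passage X (Set.Ioo (x - T) x) (Set.Ici x)) = v) :
    DownProbEq μ ζ X T x v := by
  have h := hξ.measureReal_exitDown hlam hp hc hx hxT
  refine ⟨?_, h.trans hv⟩
  rw [← hv, ← h]
  exact tendsto_setIntegral_exp_neg_mul (hξ.aemeasurable_exitTime hlam hp hc hx hxT)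
    (fun _ => ENNReal.toReal_nonneg) _

/-- As `s ↓ 0`, the infimum up to an independent exponential time of rate `s` vanishes with
probability tending to that of the walk being nonnegative at all times. -/
lemma IsInput.tendsto_pMinus (hξ : IsInput μ lam p q b c ζ X) (hlam : 0 < lam) :
    Tendsto (fun s => pMinus μ ζ X s) (𝓝[>] 0) (𝓝 (μ.real {ω | ∀ k, 0 ≤ walk X k ω})) := by
  have hw := measurable_walk hξ.measurable_jump
  have hz := measurable_walk hξ.measurable_wait
  set B : Set (Ω × ℝ) := {z | ∀ k, walk ζ k z.1 ≤ z.2 → 0 ≤ walk X k z.1}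
  have hB : MeasurableSet B := by
    have : B = ⋂ k, {z : Ω × ℝ | walk ζ k z.1 ≤ z.2}ᶜ ∪ {z : Ω × ℝ | 0 ≤ walk X k z.1} := by
      ext z
      simp [B, imp_iff_not_or]
    rw [this]
    exact .iInter fun k => (measurableSet_le ((hz k).comp measurable_fst) measurable_snd).compl.union
      (measurableSet_le measurable_const ((hw k).comp measurable_fst))
  have hR : MeasurableSet {ω | ∀ k, 0 ≤ walk X k ω} := by
    rw [Set.ofPred_forall]
    exact .iInter fun k => measurableSet_le measurable_const (hw k)
  have hEq : ∀ s : ℝ, 0 < s →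
      pMinus μ ζ X s = ∫ ω, (expMeasure s).real (Prod.mk ω ⁻¹' B) ∂μ := by
    intro s hs
    have := isProbabilityMeasure_expMeasure hs
    have h1 : {z : Ω × ℝ | runInf ζ X z.2 z.1 = 0} =ᵐ[μ.prod (expMeasure s)] B := by
      have h2 := Measure.quasiMeasurePreserving_fst.ae (hξ.ae_regularAt hlam)
        (μa := μ.prod (expMeasure s))
      have h3 := Measure.quasiMeasurePreserving_snd.ae (ae_expMeasure_pos hs)
        (μa := μ.prod (expMeasure s))
      filter_upwards [h2, h3] with z hz1 hz2
      exact propext (hz1.runInf_eq_zero_iff hz2.le)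
    rw [pMinus, measureReal_congr h1, Measure.real, Measure.prod_apply hB,
      integral_eq_lintegral_of_nonneg_ae (Eventually.of_forall fun _ => measureReal_nonneg)
        (measurable_measure_prodMk_left hB).ennreal_toReal.aestronglyMeasurable]
    simp [ofReal_measureReal]
  have hlim : Tendsto (fun s => ∫ ω, (expMeasure s).real (Prod.mk ω ⁻¹' B) ∂μ) (𝓝[>] 0)
      (𝓝 (∫ ω, {ω | ∀ k, 0 ≤ walk X k ω}.indicator (fun _ => (1 : ℝ)) ω ∂μ)) := by
    refine tendsto_integral_filter_of_dominated_convergence (fun _ => 1) ?_ ?_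
      (integrable_const _) ?_
    · filter_upwards [self_mem_nhdsWithin] with s hs
      have := isProbabilityMeasure_expMeasure (Set.mem_Ioi.1 hs)
      exact (measurable_measure_prodMk_left hB).ennreal_toReal.aestronglyMeasurable
    · filter_upwards [self_mem_nhdsWithin] with s hs
      have := isProbabilityMeasure_expMeasure (Set.mem_Ioi.1 hs)
      refine Eventually.of_forall fun ω => ?_
      rw [Real.norm_eq_abs, abs_of_nonneg measureReal_nonneg]
      exact measureReal_le_one
    · filter_upwards [hξ.ae_regularAt hlam] with ω hω
      by_cases hk : ∀ k, 0 ≤ walk X k ω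
      · have hu : Prod.mk ω ⁻¹' B = Set.univ := by
          ext t; simp [B, hk]
        rw [Set.indicator_of_mem (by exact hk), hu]
        refine tendsto_const_nhds.congr' ?_
        filter_upwards [self_mem_nhdsWithin] with s hs
        have := isProbabilityMeasure_expMeasure (Set.mem_Ioi.1 hs)
        simp
      -- If the walk is negative at step `k`, the exponential time must precede the arrival time
      -- `walk ζ k ω`; this has probability at most `1 - e^{-s walk ζ k ω}`, which tends to `0`.
      · rw [Set.indicator_of_notMem (by exact hk)]
        push Not at hk
        obtain ⟨k, hk⟩ := hk
        have hpos : 0 ≤ walk ζ k ω := by simpa using hω.strictMono.monotone (Nat.zero_le k)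
        have hc : Continuous fun s : ℝ => 1 - Real.exp (-(s * walk ζ k ω)) := by fun_prop
        have hc0 := (hc.tendsto 0).mono_left (nhdsWithin_le_nhds (s := Set.Ioi 0))
        simp only [zero_mul, neg_zero, Real.exp_zero, sub_self] at hc0
        refine tendsto_of_tendsto_of_tendsto_of_le_of_le' tendsto_const_nhds hc0
          (Eventually.of_forall fun _ => measureReal_nonneg) ?_
        filter_upwards [self_mem_nhdsWithin] with s hs
        have := isProbabilityMeasure_expMeasure (Set.mem_Ioi.1 hs)
        rw [← expMeasure_real_Iic hs hpos]
        refine measureReal_mono fun t ht => ?_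
        by_contra hcon
        exact absurd (ht k (not_le.1 hcon).le) (not_le.2 hk)
  rw [integral_indicator hR] at hlim
  simp only [integral_const, smul_eq_mul, mul_one, measureReal_restrict_apply_univ] at hlim
  refine hlim.congr' ?_
  filter_upwards [self_mem_nhdsWithin] with s hs
  exact (hEq s hs).symm

end Probability

/-! ### Explicit exit probabilities. -/

section ExitProbability

variable {Ω : Type*} [MeasurableSpace Ω] {μ : Measure Ω} [IsProbabilityMeasure μ]
  {lam p q b c : ℝ} {ζ X : ℕ → Ω → ℝ} {I : Set ℝ} {l u : ℝ}

/-- The lower endpoint may or may not belong to `I`: the open interval is needed for the exit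
problem, and `[0, n + 1)` for the event of never being negative. -/
lemma IsInput.measureReal_passage_of_harmonic (hξ : IsInput μ lam p q b c ζ X) (hp : 0 < p)
    (hq : 0 < q) (hb : 0 < b) (hc : 0 < c) (hI : MeasurableSet I) (hIoo : Set.Ioo l u ⊆ I)
    (hIco : I ⊆ Set.Ico l u) (h0 : (0 : ℝ) ∈ I) {F U D : ℝ → ℝ}
    (hU : ∀ s, HasDerivAt U (c * (U s - F s)) s) (hD : ∀ s, HasDerivAt D (b * (F s - D s)) s)
    (hUu : U u = 1) (hDl : D l = 0) (hUD : ∀ s, p * U s + q * D s = F s) :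
    μ.real (passage X I (Set.Ici u)) = F 0 := by
  have hIcc := hIco.trans Set.Ico_subset_Icc_self
  have hF : Continuous F := by
    have : F = fun s => p * U s + q * D s := funext fun s => (hUD s).symm
    rw [this]
    exact (continuous_const.mul (continuous_iff_continuousAt.2 fun s => (hU s).continuousAt)).add
      (continuous_const.mul (continuous_iff_continuousAt.2 fun s => (hD s).continuousAt))
  obtain ⟨C, hC⟩ := exists_bound_boundaryExtend hIcc hF
  have hu : 0 < u := (hIco h0).2
  have hdisj : Disjoint (Set.Ici u) I := Set.disjoint_left.2 fun s h1 h2 => not_lt.2 h1 (hIco h2).2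
  rw [measureReal_passage_eq hξ.measurable_jump hξ.indep_jump hξ.law_jump hI measurableSet_Ici
    hdisj h0 (measurable_boundaryExtend hI hF) hC
    (fun s hs => integral_boundaryExtend_jump hp hq hb hc hI hIoo hIcc h0 hF hU hD hUu hDl hUD hs)
    ?_ ?_ (hξ.ae_exists_exit hp hc hIcc)]
  · simp [boundaryExtend, h0]
  · intro s hs
    have h1 : s ∉ I := Set.disjoint_left.1 hdisj hs
    have h2 : 0 < s := hu.trans_le hs
    simp [boundaryExtend, h1, h2]
  · intro s hs hsu
    have h2 : ¬ 0 < s := fun h => hs (hIoo ⟨(hIco h0).1.trans_lt h, not_le.1 hsu⟩)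
    simp [boundaryExtend, hs, h2]

/-- The probability of exit through the upper end, for a nonzero drift. -/
lemma IsInput.measureReal_passage_exp (hξ : IsInput μ lam p q b c ζ X) (hp : 0 < p) (hq : 0 < q)
    (hpq : p + q = 1) (hb : 0 < b) (hc : 0 < c) (hI : MeasurableSet I) (hIoo : Set.Ioo l u ⊆ I)
    (hIco : I ⊆ Set.Ico l u) (h0 : (0 : ℝ) ∈ I) {r α β : ℝ} (hr : r = q * c - p * b) (hr0 : r ≠ 0)
    (hα : α = c / (p * (b + c))) (hβ : β = b / (q * (b + c))) :
    α * Real.exp (r * u) - β * Real.exp (r * l) ≠ 0 ∧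
    μ.real (passage X I (Set.Ici u))
      = (1 - β * Real.exp (r * l)) / (α * Real.exp (r * u) - β * Real.exp (r * l)) := by
  obtain rfl : p = 1 - q := by linarith
  -- `α = c / (c - r)` and `β = b / (b + r)` are the means of `e^{rY}` for an upward and a downward
  -- jump `Y`. Both `α - 1` and `1 - β` have the sign of `r`, which makes the denominator nonzero.
  have hl : l ≤ 0 := (hIco h0).1
  have hu : 0 < u := (hIco h0).2
  have hα1 : α - 1 = r / ((1 - q) * (b + c)) := by
    rw [hα, hr]; field_simp; ring
  have hβ1 : 1 - β = r / (q * (b + c)) := by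
    rw [hβ, hr]; field_simp; ring
  have hα0 : 0 < α := by rw [hα]; positivity
  have hβ0 : 0 < β := by rw [hβ]; positivity
  have hne : α * Real.exp (r * u) - β * Real.exp (r * l) ≠ 0 := by
    rcases lt_or_gt_of_ne hr0 with h | h
    · have h1 : α < 1 := by
        have : α - 1 < 0 := by rw [hα1]; exact div_neg_of_neg_of_pos h (by positivity)
        linarith
      have h2 : 1 < β := by
        have : 1 - β < 0 := by rw [hβ1]; exact div_neg_of_neg_of_pos h (by positivity)
        linarith
      have h3 : Real.exp (r * u) ≤ 1 := Real.exp_le_one_iff.2 (by nlinarith)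
      have h4 : 1 ≤ Real.exp (r * l) := Real.one_le_exp (by nlinarith)
      have : α * Real.exp (r * u) - β * Real.exp (r * l) < 0 := by nlinarith
      exact this.ne
    · have h1 : 1 < α := by
        have : 0 < α - 1 := by rw [hα1]; positivity
        linarith
      have h2 : β < 1 := by
        have : 0 < 1 - β := by rw [hβ1]; positivity
        linarith
      have h3 : 1 ≤ Real.exp (r * u) := Real.one_le_exp (by nlinarith)
      have h4 : Real.exp (r * l) ≤ 1 := Real.exp_le_one_iff.2 (by nlinarith)
      have : 0 < α * Real.exp (r * u) - β * Real.exp (r * l) := by nlinarith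
      exact this.ne'
  refine ⟨hne, ?_⟩
  set Δ := α * Real.exp (r * u) - β * Real.exp (r * l) with hΔ
  have hexp : ∀ κ s, HasDerivAt (fun s => -β * Real.exp (r * l) / Δ + 1 / Δ * κ * Real.exp (r * s))
      (1 / Δ * κ * (r * Real.exp (r * s))) s := by
    intro κ s
    have h1 : HasDerivAt (fun s => Real.exp (r * s)) (r * Real.exp (r * s)) s :=
      (((hasDerivAt_id s).const_mul r).exp).congr_deriv (by simp [mul_comm])
    exact (h1.const_mul _).const_add _
  have hrα : r * α = c * (α - 1) := by
    rw [hα, hr]; field_simp; ring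
  have hrβ : r * β = b * (1 - β) := by
    rw [hβ, hr]; field_simp; ring
  -- Averaging `A + B e^{rs}` multiplies the exponential by `α` or `β`; `U u = 1` and `D l = 0` then
  -- give `B = 1 / Δ` and `A = -β e^{rl} / Δ`.
  rw [hξ.measureReal_passage_of_harmonic hp hq hb hc hI hIoo hIco h0
    (F := fun s => -β * Real.exp (r * l) / Δ + 1 / Δ * 1 * Real.exp (r * s))
    (U := fun s => -β * Real.exp (r * l) / Δ + 1 / Δ * α * Real.exp (r * s))
    (D := fun s => -β * Real.exp (r * l) / Δ + 1 / Δ * β * Real.exp (r * s))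
    (fun s => (hexp α s).congr_deriv ?_) (fun s => (hexp β s).congr_deriv ?_) ?_ ?_ ?_]
  · simp only [mul_zero, Real.exp_zero]
    ring
  · field_simp
    rw [hΔ]; ring
  · ring
  · intro s
    have h1 : (1 - q) * α + q * β = 1 := by
      rw [hα, hβ]; field_simp; ring
    linear_combination (1 / Δ * Real.exp (r * s)) * h1
  · linear_combination (1 / Δ * Real.exp (r * s)) * hrα
  · linear_combination (1 / Δ * Real.exp (r * s)) * hrβ

/-- The probability of exit through the upper end, for zero drift. -/
lemma IsInput.measureReal_passage_linear (hξ : IsInput μ lam p q b c ζ X) (hp : 0 < p) (hq : 0 < q)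
    (hpq : p + q = 1) (hb : 0 < b) (hc : 0 < c) (hI : MeasurableSet I) (hIoo : Set.Ioo l u ⊆ I)
    (hIco : I ⊆ Set.Ico l u) (h0 : (0 : ℝ) ∈ I) (hr : p / c = q / b) :
    μ.real (passage X I (Set.Ici u)) = c * (1 - b * l) / (b + c + b * c * (u - l)) := by
  have hl : l ≤ 0 := (hIco h0).1
  have hu : 0 < u := (hIco h0).2
  have hΔ : 0 < b + c + b * c * (u - l) := by
    have : 0 ≤ u - l := by linarith
    positivity
  set Δ := b + c + b * c * (u - l) with hΔe
  have hlin : ∀ κ s, HasDerivAt (fun s => c * (1 - b * l) / Δ + b * c / Δ * (s + κ))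
      (b * c / Δ) s := by
    intro κ s
    have h1 : HasDerivAt (fun s : ℝ => s + κ) 1 s := (hasDerivAt_id s).add_const κ
    exact ((h1.const_mul _).const_add _).congr_deriv (by ring)
  -- Averaging a linear function shifts its argument by the mean jump, `1 / c` upwards and `-1 / b`
  -- downwards; zero drift makes these shifts cancel.
  rw [hξ.measureReal_passage_of_harmonic hp hq hb hc hI hIoo hIco h0
    (F := fun s => c * (1 - b * l) / Δ + b * c / Δ * (s + 0))
    (U := fun s => c * (1 - b * l) / Δ + b * c / Δ * (s + 1 / c))
    (D := fun s => c * (1 - b * l) / Δ + b * c / Δ * (s + -(1 / b)))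
    (fun s => (hlin _ s).congr_deriv ?_) (fun s => (hlin _ s).congr_deriv ?_) ?_ ?_ ?_]
  · simp
  · field_simp
    rw [hΔe]; ring
  · field_simp
    ring
  · intro s
    linear_combination (c * (1 - b * l) / Δ + b * c / Δ * s) * hpq + (b * c / Δ) * hr
  · field_simp
    ring
  · field_simp
    ring

/-- For a positive drift, the probability that the walk never becomes negative. -/
lemma IsInput.measureReal_forall_nonneg (hξ : IsInput μ lam p q b c ζ X) (hp : 0 < p) (hq : 0 < q)
    (hpq : p + q = 1) (hb : 0 < b) (hc : 0 < c) (hr : q * c - p * b < 0) :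
    μ.real {ω | ∀ k, 0 ≤ walk X k ω} = (p * b - q * c) / b := by
  have hw := measurable_walk hξ.measurable_jump
  have hR : MeasurableSet {ω | ∀ k, 0 ≤ walk X k ω} := by
    rw [Set.ofPred_forall]
    exact .iInter fun k => measurableSet_le measurable_const (hw k)
  set A : ℕ → Set Ω := fun n => passage X (Set.Ico 0 ((n : ℝ) + 1)) (Set.Ici ((n : ℝ) + 1))
  have hA : ∀ n, MeasurableSet (A n) := fun n =>
    measurableSet_passage hξ.measurable_jump measurableSet_Ico measurableSet_Ici
  -- A walk that is never negative leaves every `[0, n + 1)` upwards. One that is negative at step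
  -- `k` is bounded before then, so it cannot pass a high level first.
  have hlim : Tendsto (fun n => μ.real (A n)) atTop (𝓝 (μ.real {ω | ∀ k, 0 ≤ walk X k ω})) := by
    refine (ENNReal.tendsto_toReal (measure_ne_top _ _)).comp
      (tendsto_measure_of_ae_tendsto_indicator_of_isFiniteMeasure atTop hR hA ?_)
    have hex : ∀ᵐ ω ∂μ, ∀ n : ℕ, ∃ k, walk X k ω ∉ Set.Ico (0 : ℝ) ((n : ℝ) + 1) :=
      ae_all_iff.2 fun n => hξ.ae_exists_exit hp hc Set.Ico_subset_Icc_self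
    filter_upwards [hex] with ω hω
    by_cases hk : ∀ k, 0 ≤ walk X k ω
    · refine Eventually.of_forall fun n => iff_of_true ?_ hk
      obtain ⟨N, -, hN, hj⟩ := exists_first_exit (I := Set.Ico (0 : ℝ) ((n : ℝ) + 1))
        ⟨le_rfl, by positivity⟩ (hω n)
      exact ⟨N, not_lt.1 fun h => hN ⟨hk N, h⟩, hj⟩
    · have hk' := hk
      push Not at hk
      obtain ⟨k, hk⟩ := hk
      obtain ⟨M, hM⟩ := ((Set.finite_Iic k).image fun j => walk X j ω).bddAbove
      obtain ⟨m, hm⟩ := exists_nat_gt M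
      filter_upwards [eventually_ge_atTop m] with n hn
      refine iff_of_false ?_ hk'
      rintro ⟨j, hj1, hj2⟩
      rcases Nat.lt_or_ge k j with h | h
      · exact absurd (hj2 k h).1 (not_le.2 hk)
      · have h1 : walk X j ω ≤ M := hM ⟨j, h, rfl⟩
        have h2 : (m : ℝ) ≤ n := by exact_mod_cast hn
        have h3 : (n : ℝ) + 1 ≤ walk X j ω := hj1
        linarith
  have hval : ∀ n : ℕ, μ.real (A n) = (1 - b / (q * (b + c))) /
      (c / (p * (b + c)) * Real.exp ((q * c - p * b) * ((n : ℝ) + 1)) - b / (q * (b + c))) := by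
    intro n
    have h := (hξ.measureReal_passage_exp hp hq hpq hb hc (I := Set.Ico (0 : ℝ) ((n : ℝ) + 1))
      (l := 0) (u := (n : ℝ) + 1) measurableSet_Ico Set.Ioo_subset_Ico_self subset_rfl
      ⟨le_rfl, by positivity⟩ rfl hr.ne rfl rfl).2
    simpa using h
  have hexp : Tendsto (fun n : ℕ => Real.exp ((q * c - p * b) * ((n : ℝ) + 1))) atTop (𝓝 0) := by
    refine Real.tendsto_exp_atBot.comp (Tendsto.const_mul_atTop_of_neg hr ?_)
    exact tendsto_atTop_add_const_right _ _ tendsto_natCast_atTop_atTop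
  have hβ : 0 < b / (q * (b + c)) := by positivity
  have hlim2 : Tendsto (fun n => μ.real (A n)) atTop (𝓝 ((1 - b / (q * (b + c))) /
      (c / (p * (b + c)) * 0 - b / (q * (b + c))))) := by
    simp only [hval]
    refine tendsto_const_nhds.div ((hexp.const_mul _).sub_const _) ?_
    simpa using hβ.ne'
  rw [tendsto_nhds_unique hlim hlim2]
  obtain rfl : p = 1 - q := by linarith
  field_simp
  ring

end ExitProbability

/-! ### The root of the cumulant, the sign of the drift, and the conclusion. -/

lemma cumulant_root {lam p q b c : ℝ} (hp : 0 < p) (hq : 0 < q) (hpq : p + q = 1) (hb : 0 < b)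
    (hc : 0 < c) : cumulant lam p q b c (-Complex.I * ((q * c - p * b : ℝ) : ℂ)) = 0 := by
  obtain rfl : p = 1 - q := by linarith
  have hI : Complex.I * (-Complex.I * ((q * c - (1 - q) * b : ℝ) : ℂ))
      = ((q * c - (1 - q) * b : ℝ) : ℂ) := by
    rw [← mul_assoc, mul_neg, Complex.I_mul_I]; simp
  have h : (1 - q) * (c * (c - (q * c - (1 - q) * b))⁻¹ - 1)
      + q * (b * (b + (q * c - (1 - q) * b))⁻¹ - 1) = 0 := by
    have e1 : c - (q * c - (1 - q) * b) = (1 - q) * (b + c) := by ring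
    have e2 : b + (q * c - (1 - q) * b) = q * (b + c) := by ring
    rw [e1, e2]
    field_simp
    ring
  have hC := congrArg (fun v : ℝ => (lam : ℂ) * (v : ℂ)) h
  rw [cumulant, hI]
  push_cast at hC ⊢
  linear_combination hC

lemma drift_pos_iff {lam p q b c : ℝ} (hlam : 0 < lam) (hb : 0 < b) (hc : 0 < c) :
    0 < drift lam p q b c ↔ q * c - p * b < 0 := by
  rw [drift, mul_pos_iff_of_pos_left hlam, sub_pos, div_lt_div_iff₀ hb hc, sub_neg]

lemma drift_neg_iff {lam p q b c : ℝ} (hlam : 0 < lam) (hb : 0 < b) (hc : 0 < c) :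
    drift lam p q b c < 0 ↔ 0 < q * c - p * b := by
  rw [drift, ← neg_pos, ← mul_neg, mul_pos_iff_of_pos_left hlam, neg_sub, sub_pos,
    div_lt_div_iff₀ hc hb, sub_pos]

end CompoundPoisson

theorem corollary3 {Ω : Type*} [MeasurableSpace Ω] (μ : Measure Ω) [IsProbabilityMeasure μ]
    (lam p q b c : ℝ) (hlam : 0 < lam) (hp : 0 < p) (hq : 0 < q) (hpq : p + q = 1)
    (hb : 0 < b) (hc : 0 < c) (ζ X : ℕ → Ω → ℝ) (hξ : IsInput μ lam p q b c ζ X) :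
    (0 < drift lam p q b c →
      ∃ pm qm ρm : ℝ,
        Tendsto (fun s => pMinus μ ζ X s) (𝓝[>] 0) (𝓝 pm) ∧ qm = 1 - pm ∧ ρm = b * pm ∧
        0 < ρm ∧ cumulant lam p q b c (-Complex.I * ((-ρm : ℝ) : ℂ)) = 0 ∧
        ∀ x T : ℝ, 0 < x → x < T →
          UpProbEq μ ζ X T x
            ((1 - qm * Real.exp (ρm * (x - T))) *
              (1 - qm * c * (c + ρm)⁻¹ * Real.exp (-ρm * T))⁻¹)) ∧
    (drift lam p q b c < 0 →
      ∃ pp qp ρp : ℝ,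
        Tendsto (fun s => pPlus μ ζ X s) (𝓝[>] 0) (𝓝 pp) ∧ qp = 1 - pp ∧ ρp = c * pp ∧
        0 < ρp ∧ cumulant lam p q b c (-Complex.I * (ρp : ℂ)) = 0 ∧
        ∀ x T : ℝ, 0 < x → x < T →
          UpProbEq μ ζ X T x
            (qp * Real.exp (-ρp * x) * (1 - b * (ρp + b)⁻¹ * Real.exp (ρp * (x - T))) *
              (1 - b * (ρp + b)⁻¹ * qp * Real.exp (-ρp * T))⁻¹)) ∧
    (drift lam p q b c = 0 →
      ∀ x T : ℝ, 0 < x → x < T →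
        UpProbEq μ ζ X T x (c * (1 + b * (T - x)) / (b + c + b * c * T))) ∧
    (p = 1 / 2 → q = 1 / 2 → b = c →
      ∀ x T : ℝ, 0 < x → x < T →
        UpProbEq μ ζ X T x ((1 + c * (T - x)) / (2 + c * T)) ∧
        DownProbEq μ ζ X T x ((1 + c * x) / (2 + c * T))) := by
  have hIoo : ∀ {x T : ℝ}, 0 < x → x < T → (0 : ℝ) ∈ Set.Ioo (x - T) x :=
    fun hx hxT => ⟨by linarith, hx⟩
  have hzero : p / c = q / b → ∀ x T : ℝ, 0 < x → x < T →
      μ.real (passage X (Set.Ioo (x - T) x) (Set.Ici x))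
        = c * (1 + b * (T - x)) / (b + c + b * c * T) := by
    intro hr x T hx hxT
    rw [hξ.measureReal_passage_linear hp hq hpq hb hc measurableSet_Ioo subset_rfl
      Set.Ioo_subset_Ico_self (hIoo hx hxT) hr]
    congr 1 <;> ring
  refine ⟨fun hm => ?_, fun hm => ?_, fun hm x T hx hxT => ?_, fun hp2 hq2 hbc x T hx hxT => ?_⟩
  · have hr := (drift_pos_iff hlam hb hc).1 hm
    refine ⟨(p * b - q * c) / b, 1 - (p * b - q * c) / b, p * b - q * c, ?_, rfl, ?_, by linarith,
      ?_, fun x T hx hxT => ?_⟩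
    · rw [← hξ.measureReal_forall_nonneg hp hq hpq hb hc hr]
      exact hξ.tendsto_pMinus hlam
    · field_simp
    · rw [neg_sub]
      exact cumulant_root hp hq hpq hb hc
    · refine hξ.upProbEq hlam hp hc hx hxT ?_
      obtain ⟨hne, h⟩ := hξ.measureReal_passage_exp hp hq hpq hb hc measurableSet_Ioo subset_rfl
        Set.Ioo_subset_Ico_self (hIoo hx hxT) rfl hr.ne rfl rfl
      rw [h]
      obtain rfl : p = 1 - q := by linarith
      set ρ := (1 - q) * b - q * c with hρ
      have e1 : Real.exp ((q * c - (1 - q) * b) * x) = Real.exp (-ρ * x) := by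
        congr 1; rw [hρ]; ring
      have e2 : Real.exp ((q * c - (1 - q) * b) * (x - T)) = (Real.exp (ρ * (x - T)))⁻¹ := by
        rw [← Real.exp_neg]; congr 1; rw [hρ]; ring
      have e3 : Real.exp (-ρ * T) = Real.exp (-ρ * x) * Real.exp (ρ * (x - T)) := by
        rw [← Real.exp_add]; congr 1; ring
      -- Here `q_- = 1 / β` and `q_- c / (c + ρ_-) = α / β`: the stated formula is the exit formula
      -- with numerator and denominator divided by `-β e^{rl}`.
      have e4 : 1 - ρ / b = (b / (q * (b + c)))⁻¹ := by rw [hρ]; field_simp; ring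
      have e5 : (1 - ρ / b) * c * (c + ρ)⁻¹ = (b / (q * (b + c)))⁻¹ * (c / ((1 - q) * (b + c))) := by
        rw [e4, mul_assoc, show c + ρ = (1 - q) * (b + c) by rw [hρ]; ring, ← div_eq_mul_inv]
      rw [e1, e2] at hne
      rw [e1, e2, e5, e4, e3]
      have hβ : b / (q * (b + c)) ≠ 0 := by positivity
      have hE := (Real.exp_pos (ρ * (x - T))).ne'
      generalize Real.exp (ρ * (x - T)) = E at *
      generalize Real.exp (-ρ * x) = G at *
      generalize b / (q * (b + c)) = β at *
      generalize c / ((1 - q) * (b + c)) = α at *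
      have hne2 : 1 - β⁻¹ * α * (G * E) ≠ 0 := by
        intro h0
        apply hne
        field_simp at h0 ⊢
        linear_combination -h0
      rw [eq_mul_inv_iff_mul_eq₀ hne2, div_mul_eq_mul_div, div_eq_iff hne]
      field_simp
      ring
  · have hr := (drift_neg_iff hlam hb hc).1 hm
    refine ⟨(q * c - p * b) / c, 1 - (q * c - p * b) / c, q * c - p * b, ?_, rfl, ?_, hr,
      cumulant_root hp hq hpq hb hc, fun x T hx hxT => ?_⟩
    · rw [pPlus_eq_pMinus_neg, ← hξ.neg.measureReal_forall_nonneg hq hp (by linarith) hc hb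
        (by linarith)]
      exact hξ.neg.tendsto_pMinus hlam
    · field_simp
    · refine hξ.upProbEq hlam hp hc hx hxT ?_
      obtain ⟨hne, h⟩ := hξ.measureReal_passage_exp hp hq hpq hb hc measurableSet_Ioo subset_rfl
        Set.Ioo_subset_Ico_self (hIoo hx hxT) rfl hr.ne' rfl rfl
      rw [h]
      obtain rfl : p = 1 - q := by linarith
      set ρ := q * c - (1 - q) * b with hρ
      have e2 : Real.exp (-ρ * x) = (Real.exp (ρ * x))⁻¹ := by
        rw [← Real.exp_neg]; congr 1; ring
      have e3 : Real.exp (-ρ * T) = (Real.exp (ρ * x))⁻¹ * Real.exp (ρ * (x - T)) := by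
        rw [← Real.exp_neg, ← Real.exp_add]; congr 1; ring
      -- Here `q_+ = 1 / α` and `b / (ρ_+ + b) = β`: numerator and denominator of the exit formula
      -- are divided by `α e^{ru}`.
      have e4 : 1 - ρ / c = (c / ((1 - q) * (b + c)))⁻¹ := by rw [hρ]; field_simp; ring
      have e5 : b * (ρ + b)⁻¹ = b / (q * (b + c)) := by
        rw [show ρ + b = q * (b + c) by rw [hρ]; ring, ← div_eq_mul_inv]
      rw [e5, e4, e3, e2]
      have hα : c / ((1 - q) * (b + c)) ≠ 0 := by positivity
      have hE := (Real.exp_pos (ρ * x)).ne'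
      generalize Real.exp (ρ * (x - T)) = E at *
      generalize Real.exp (ρ * x) = G at *
      generalize b / (q * (b + c)) = β at *
      generalize c / ((1 - q) * (b + c)) = α at *
      have hne2 : 1 - β * α⁻¹ * (G⁻¹ * E) ≠ 0 := by
        intro h0
        apply hne
        field_simp at h0 ⊢
        linear_combination h0
      rw [eq_mul_inv_iff_mul_eq₀ hne2, div_mul_eq_mul_div, div_eq_iff hne]
      field_simp
  · refine hξ.upProbEq hlam hp hc hx hxT (hzero ?_ x T hx hxT)
    have := (mul_eq_zero.1 hm).resolve_left hlam.ne'
    linarith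
  · subst hp2 hq2 hbc
    have hT : 0 < T := hx.trans hxT
    have h := hzero rfl x T hx hxT
    constructor
    · refine hξ.upProbEq hlam hp hc hx hxT (h.trans ?_)
      field_simp
      ring
    · refine hξ.downProbEq hlam hp hc hx hxT ?_
      rw [h]
      field_simp
      ring
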